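/- Let $n$ be an even natural number and let $\mathcal A=\{1,\dots,n\}$ label $n$ qubits, with Hilbert space $\mathcal H_{\mathcal A}=(\mathbb C^2)^{\otimes n}$. For a density operator $\rho$ on $\mathcal H_{\mathcal A}$ and $J\subseteq\mathcal A$ let $\rho_J$ be the partial trace of $\rho$ over the qubits outside $J$, let $S_2(J)_\rho=1-\operatorname{Tr}\rho_J^2$ (so $S_2(\varnothing)_\rho=0$), and set $$C_2(J)_\rho=\sum_{v\in J}S_2(\{v\})_\rho-S_2(J)_\rho,\qquad I_2(\mathcal A)_\rho=\sum_{J\subseteq\mathcal A}(-1)^{|J|-1}S_2(J)_\rho .$$ For $\varepsilon\in\mathbb R$ let $G(\varepsilon)_\rho=\{\varnothing\ne J\subseteq\mathcal A : C_2(J)_\rho\le\varepsilon\}$, let $\widetilde\beta_k(\varepsilon)_\rho$ be the $k$-th reduced Betti number ($k\ge 0$) of $G(\varepsilon)_\rho$ with coefficients in $\mathbb Z_2$, and define the reduced integrated Euler characteristic $$\widetilde{\mathfrak X}_2(\varepsilon)_\rho=\sum_{k\ge0}(-1)^k\int_0^{\varepsilon}\widetilde\beta_k(t)_\rho\,dt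 .$$ Then for every density operator $\rho$ on $\mathcal H_{\mathcal A}$ each $G(\varepsilon)_\rho$ is an abstract simplicial complex, the limit $\widetilde{\mathfrak X}_2(\infty)_\rho=\lim_{\varepsilon\to\infty}\widetilde{\mathfrak X}_2(\varepsilon)_\rho$ exists, and $$\widetilde{\mathfrak X}_2(\infty)_\rho=I_2(\mathcal A)_\rho .$$ Moreover, $\widetilde{\mathfrak X}_2(\infty)$ is an entanglement monotone, i.e. it does not increase on average under local Kraus operations (in particular under LOCC, resolved into product Kraus operators): for every density operator $\rho$ and every finite family of product operators $K_i=K_{i,1}\otimes\dots\otimes K_{i,n}$, with $K_{i,j}$ a linear operator on $\mathbb C^2$ and $\sum_iK_i^\dagger K_i=1$, $$\sum_{i:\,p_i>0}p_i\,\widetilde{\mathfrak X}_2(\infty)_{\sigma_i}\le\widetilde{\mathfrak X}_2(\infty)_\rho,\qquad p_i=\operatorname{Tr}(K_i\rho K_i^\dagger),\quad \sigma_i=\frac{K_i\rho K_i^\dagger}{p_i}.$$ -/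

import Mathlib

open scoped ComplexOrder Matrix Topology

noncomputable section

namespace QubitPersistence

/-- Operators on the Hilbert space `(ℂ²)^{⊗ n}`, as matrices in the standard product basis, whose
elements are labelled by the bit strings `Fin n → Fin 2`. -/
abbrev Op (n : ℕ) : Type := Matrix (Fin n → Fin 2) (Fin n → Fin 2) ℂ

/-- Density operators: positive semidefinite with trace one. -/
def IsState {n : ℕ} (ρ : Op n) : Prop :=
  ρ.PosSemidef ∧ ρ.trace = 1

/-- The bit string on all qubits that is `a` on `J` and `c` on the complement of `J`. -/
def glue {n : ℕ} (J : Finset (Fin n)) (a : {i // i ∈ J} → Fin 2) (c : {i // i ∉ J} → Fin 2) :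
    Fin n → Fin 2 :=
  fun i => if h : i ∈ J then a ⟨i, h⟩ else c ⟨i, h⟩

/-- The marginal `ρ_J`: the partial trace over all qubits outside `J`. -/
def marginal {n : ℕ} (ρ : Op n) (J : Finset (Fin n)) :
    Matrix ({i // i ∈ J} → Fin 2) ({i // i ∈ J} → Fin 2) ℂ :=
  Matrix.of fun a b => ∑ c : {i // i ∉ J} → Fin 2, ρ (glue J a c) (glue J b c)

/-- The linear entropy (Tsallis entropy with `q = 2`) `S₂(J)_ρ = 1 - Tr ρ_J²`. For a state and
`J = ∅` it is `0`, since then `ρ_J` is the `1 × 1` matrix with entry `Tr ρ = 1`. -/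
def linearEntropy {n : ℕ} (ρ : Op n) (J : Finset (Fin n)) : ℝ :=
  1 - (marginal ρ J * marginal ρ J).trace.re

/-- The deformed total correlation `C₂(J)_ρ = ∑_{v ∈ J} S₂(v)_ρ - S₂(J)_ρ`. -/
def totalCorrelation {n : ℕ} (ρ : Op n) (J : Finset (Fin n)) : ℝ :=
  ∑ v ∈ J, linearEntropy ρ {v} - linearEntropy ρ J

/-- The deformed interaction information `I₂(𝒜)_ρ = ∑_{J ⊆ 𝒜} (-1)^{|J|-1} S₂(J)_ρ`;
the sign is written `(-1)^{|J|+1}` to avoid truncated subtraction. -/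
def interactionInformation {n : ℕ} (ρ : Op n) : ℝ :=
  ∑ J : Finset (Fin n), (-1 : ℝ) ^ (J.card + 1) * linearEntropy ρ J

/-- The sublevel set `G(ε)_ρ` of the functional `C₂` on the nonempty sets of qubits. -/
def sublevelComplex {n : ℕ} (ρ : Op n) (ε : ℝ) : Set (Finset (Fin n)) :=
  {J | J.Nonempty ∧ totalCorrelation ρ J ≤ ε}

/-! ### Reduced simplicial homology with coefficients in `ZMod 2` -/

/-- The boundary operator of the augmented chain complex of the full simplex on `Fin n`: a set `J`
is sent to the sum of the sets `J \ {v}`, `v ∈ J` (signs do not matter modulo two). The empty set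
is the generator in degree `-1`, so that on `0`-chains this is the augmentation
`∑ σ_k ↦ (number of summands) mod 2`. -/
def boundary (n : ℕ) : (Finset (Fin n) → ZMod 2) →ₗ[ZMod 2] (Finset (Fin n) → ZMod 2) :=
  ∑ J : Finset (Fin n), (LinearMap.proj J).smulRight (∑ v ∈ J, Pi.single (J.erase v) 1)

/-- The `k`-chains of `G`: combinations of the members of `G` with `k + 1` vertices. -/
def chains {n : ℕ} (G : Set (Finset (Fin n))) (k : ℕ) :
    Submodule (ZMod 2) (Finset (Fin n) → ZMod 2) where
  carrier := {c | ∀ J, c J ≠ 0 → J ∈ G ∧ J.card = k + 1}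
  zero_mem' := fun J h => absurd rfl h
  add_mem' := by
    intro a b ha hb J h
    by_cases h0 : a J = 0
    · exact hb J fun h1 => h (by simp [h0, h1])
    · exact ha J h0
  smul_mem' := by
    intro r a ha J h
    exact ha J fun h1 => h (by simp [h1])

/-- The reduced `k`-cycles of `G`. -/
def cycles {n : ℕ} (G : Set (Finset (Fin n))) (k : ℕ) :
    Submodule (ZMod 2) (Finset (Fin n) → ZMod 2) :=
  chains G k ⊓ LinearMap.ker (boundary n)

/-- The `k`-boundaries of `G`. -/
def boundaries {n : ℕ} (G : Set (Finset (Fin n))) (k : ℕ) :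
    Submodule (ZMod 2) (Finset (Fin n) → ZMod 2) :=
  (chains G (k + 1)).map (boundary n)

/-- The reduced homology group of degree `k` of a simplicial complex `G` (a family of nonempty
sets that is closed under taking nonempty subsets): cycles modulo boundaries. -/
abbrev ReducedHomology {n : ℕ} (G : Set (Finset (Fin n))) (k : ℕ) : Type :=
  cycles G k ⧸ (boundaries G k).submoduleOf (cycles G k)

/-- The reduced Betti number of degree `k`. -/
def reducedBetti {n : ℕ} (G : Set (Finset (Fin n))) (k : ℕ) : ℕ :=
  Module.finrank (ZMod 2) (ReducedHomology G k)

/-! ### The topological summary -/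

/-- The reduced integrated Betti number of the persistence complex of `ρ`. -/
def reducedIntegratedBetti {n : ℕ} (ρ : Op n) (k : ℕ) (ε : ℝ) : ℝ :=
  ∫ t in (0 : ℝ)..ε, (reducedBetti (sublevelComplex ρ t) k : ℝ)

/-- The reduced integrated Euler characteristic of the persistence complex of `ρ`. (Only the terms
with `k < n` can be nonzero.) -/
def reducedIEC {n : ℕ} (ρ : Op n) (ε : ℝ) : ℝ :=
  ∑' k : ℕ, (-1 : ℝ) ^ k * reducedIntegratedBetti ρ k ε

/-- The value at infinity of the reduced integrated Euler characteristic. -/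
def reducedIECInfty {n : ℕ} (ρ : Op n) : ℝ :=
  Filter.limUnder Filter.atTop (reducedIEC ρ)

/-! ### Local operations and monotones -/

/-- The tensor product `K_1 ⊗ ⋯ ⊗ K_n` of operators on the individual qubits. -/
def localOp {n : ℕ} (K : Fin n → Matrix (Fin 2) (Fin 2) ℂ) : Op n :=
  Matrix.of fun a b => ∏ j, K j (a j) (b j)

/-- The probability `p = Tr(K ρ K†)` of the outcome with Kraus operator `K`. -/
def outcomeProb {n : ℕ} (K ρ : Op n) : ℝ :=
  (K * ρ * Kᴴ).trace.re

/-- The post-measurement state `K ρ K† / Tr(K ρ K†)`. -/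
def postState {n : ℕ} (K ρ : Op n) : Op n :=
  ((outcomeProb K ρ)⁻¹ : ℂ) • (K * ρ * Kᴴ)

/-- `T` is an entanglement monotone: it does not increase on average under any operation given by
finitely many local Kraus operators `K_i = ⨂_j K_{i,j}` with `∑_i K_i† K_i = 1`. An outcome of
probability zero contributes `0` to the average. -/
def IsEntanglementMonotone {n : ℕ} (T : Op n → ℝ) : Prop :=
  ∀ ρ : Op n, IsState ρ →
    ∀ (m : ℕ) (K : Fin m → Fin n → Matrix (Fin 2) (Fin 2) ℂ),
      ∑ i, (localOp (K i))ᴴ * localOp (K i) = 1 →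
        ∑ i, outcomeProb (localOp (K i)) ρ * T (postState (localOp (K i)) ρ) ≤ T ρ

end QubitPersistence

end

/-! The purity of a marginal is the trace of `ρ ⊗ ρ` against the operator `W_J` that swaps two
copies of the qubits in `J`. For disjoint `A`, `B` the product `(1 - W_A)(1 - W_B)` is a positive
multiple of a projection; its nonnegative expectation is subadditivity of `S₂`
(`purity_add_purity_le`). Hence `C₂` is monotone and its sublevel sets are simplicial complexes.

For `t ≥ 0` every vertex is present, so Euler–Poincaré (`sum_reducedBetti`) turns the alternating
sum of reduced Betti numbers into a signed count of all `J`, now including `∅`, with `C₂(J) ≤ t`.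
Integrating up to a large `ε` gives `∑ (-1)^(|J|+1) (ε - C₂(J))`. The `ε` terms cancel, and so do
the one-qubit entropies once `n ≥ 2`; what is left is `I₂` (`reducedIEC_eq`).

For monotonicity, `I₂` is rewritten as the overlap `Q` of `ρ` with its spin flip
(`interactionInformation_eq`). Since `Aᵀ ε A = det A • ε` on each qubit, a product operator `K`
multiplies the overlap by `|d|²`, `d` being the product of its determinants, so an outcome of
probability `p > 0` contributes `|d|² Q / p`. Cauchy–Schwarz bounds `|d|² / p` by the outcome
probability `q` of the adjoint of the adjugate of `K` (`normSq_le_outcomeProb_mul`). These adjoints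
again form a Kraus family (`sum_flipAdjugate`), so the `q` sum to one, and `Q ≥ 0` finishes the
argument. -/

namespace QubitPersistence

/-! ### Purities of marginals -/

/-- The bit strings on `J` and on its complement, glued to a bit string on all qubits. -/
def glueEquiv {n : ℕ} (J : Finset (Fin n)) :
    ({i // i ∈ J} → Fin 2) × ({i // i ∉ J} → Fin 2) ≃ (Fin n → Fin 2) where
  toFun p := glue J p.1 p.2
  invFun x := (fun i => x i, fun i => x i)
  left_inv p := by
    ext i
    · simp [glue, i.2]
    · simp [glue, i.2]
  right_inv x := by
    ext i
    simp [glue]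

theorem piecewise_glue {n : ℕ} (J : Finset (Fin n)) (a b : {i // i ∈ J} → Fin 2)
    (c d : {i // i ∉ J} → Fin 2) : J.piecewise (glue J b d) (glue J a c) = glue J b c := by
  ext i
  by_cases h : i ∈ J <;> simp [glue, h]

theorem trace_marginal_mul_self {n : ℕ} (ρ : Op n) (J : Finset (Fin n)) :
    (marginal ρ J * marginal ρ J).trace =
      ∑ x, ∑ y, ρ x (J.piecewise y x) * ρ y (J.piecewise x y) := by
  rw [← (glueEquiv J).sum_comp, Fintype.sum_prod_type]
  simp_rw [← (glueEquiv J).sum_comp (fun y => ρ _ (J.piecewise y _) * ρ y _),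
    Fintype.sum_prod_type]
  simp only [glueEquiv, Equiv.coe_fn_mk, piecewise_glue, Matrix.trace, Matrix.diag,
    Matrix.mul_apply, marginal, Matrix.of_apply, Finset.sum_mul_sum]
  exact Finset.sum_congr rfl fun a _ => Finset.sum_comm

/-- The exchange of two copies of the qubits in `J`, as a permutation of pairs of bit strings. -/
def swapPerm {n : ℕ} (J : Finset (Fin n)) :
    Equiv.Perm ((Fin n → Fin 2) × (Fin n → Fin 2)) where
  toFun p := (J.piecewise p.2 p.1, J.piecewise p.1 p.2)
  invFun p := (J.piecewise p.2 p.1, J.piecewise p.1 p.2)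
  left_inv p := by
    ext i <;> by_cases h : i ∈ J <;> simp [h]
  right_inv p := by
    ext i <;> by_cases h : i ∈ J <;> simp [h]

theorem swapPerm_mul_self {n : ℕ} (J : Finset (Fin n)) : swapPerm J * swapPerm J = 1 :=
  Equiv.ext (swapPerm J).left_inv

theorem swapPerm_inv {n : ℕ} (J : Finset (Fin n)) : (swapPerm J)⁻¹ = swapPerm J := rfl

theorem swapPerm_mul {n : ℕ} {A B : Finset (Fin n)} (h : Disjoint A B) :
    swapPerm A * swapPerm B = swapPerm (A ∪ B) := by
  ext p i <;> by_cases hA : i ∈ A <;> by_cases hB : i ∈ B <;>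
    simp [swapPerm, hA, hB]
  all_goals exact absurd hB (Finset.disjoint_left.mp h hA)

-- The swap trick: it makes the purity linear in `ρ ⊗ ρ`.
open scoped Kronecker in
theorem trace_kronecker_mul_swapPerm {n : ℕ} (ρ : Op n) (J : Finset (Fin n)) :
    ((ρ ⊗ₖ ρ) * (swapPerm J).permMatrix ℂ).trace = (marginal ρ J * marginal ρ J).trace := by
  rw [trace_marginal_mul_self, ← Fintype.sum_prod_type']
  rw [Equiv.Perm.permMatrix, PEquiv.mul_toMatrix_toPEquiv]
  rfl

theorem trace_marginal_empty_mul_self {n : ℕ} (ρ : Op n) :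
    (marginal ρ ∅ * marginal ρ ∅).trace = ρ.trace ^ 2 := by
  rw [trace_marginal_mul_self]
  simp [Matrix.trace, sq, Finset.sum_mul_sum]

/-- Here `P` is `c` times a projection, so `Tr (P R P†) = c Tr (R P)`. -/
theorem trace_nonneg_of_mul_self {ι : Type*} [Fintype ι] [DecidableEq ι] {R P : Matrix ι ι ℂ}
    (hR : R.PosSemidef) (hP : P.IsHermitian) {c : ℝ} (hc : 0 < c) (h : P * P = (c : ℂ) • P) :
    0 ≤ (R * P).trace.re := by
  have h1 : 0 ≤ (P * R * Pᴴ).trace := (hR.mul_mul_conjTranspose_same P).trace_nonneg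
  rw [hP.eq, Matrix.mul_assoc, Matrix.trace_mul_comm, Matrix.mul_assoc, h, Matrix.mul_smul,
    Matrix.trace_smul] at h1
  have h2 := (Complex.le_def.mp h1).1
  simp only [smul_eq_mul, Complex.re_ofReal_mul, Complex.zero_re] at h2
  exact nonneg_of_mul_nonneg_right h2 hc

open scoped Kronecker in
theorem purity_add_purity_le {n : ℕ} {ρ : Op n} (hρ : IsState ρ) {A B : Finset (Fin n)}
    (h : Disjoint A B) :
    (marginal ρ A * marginal ρ A).trace.re + (marginal ρ B * marginal ρ B).trace.re ≤
      1 + (marginal ρ (A ∪ B) * marginal ρ (A ∪ B)).trace.re := by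
  set W : Finset (Fin n) → Matrix _ _ ℂ := fun J => (swapPerm J).permMatrix ℂ with hW
  have hsq : ∀ J, W J * W J = 1 := fun J => by
    simp only [hW]
    rw [← Matrix.permMatrix_mul, swapPerm_mul_self, Matrix.permMatrix_one]
  have hmul : W A * W B = W (A ∪ B) := by
    simp only [hW]
    rw [← Matrix.permMatrix_mul, swapPerm_mul h.symm, Finset.union_comm]
  have hmul' : W B * W A = W (A ∪ B) := by
    simp only [hW]
    rw [← Matrix.permMatrix_mul, swapPerm_mul h]
  have hher : ∀ J, (W J)ᴴ = W J := fun J => by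
    simp only [hW]
    rw [Matrix.conjTranspose_permMatrix, swapPerm_inv]
  -- Each factor `1 - W` squares to twice itself and the two commute, which yields the constant 4.
  have key := trace_nonneg_of_mul_self (R := ρ ⊗ₖ ρ) (P := (1 - W A) * (1 - W B)) (c := 4)
    (hρ.1.kronecker hρ.1) ?_ (by norm_num) ?_
  · have h1 : (1 - W A) * (1 - W B) = 1 - W A - W B + W (A ∪ B) := by
      rw [← hmul]; noncomm_ring
    rw [h1, Matrix.mul_add, Matrix.mul_sub, Matrix.mul_sub, Matrix.mul_one, Matrix.trace_add,
      Matrix.trace_sub, Matrix.trace_sub, Matrix.trace_kronecker, hρ.2] at key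
    simp only [hW, trace_kronecker_mul_swapPerm] at key
    simp at key
    linarith
  · rw [Matrix.IsHermitian, Matrix.conjTranspose_mul]
    simp only [Matrix.conjTranspose_sub, Matrix.conjTranspose_one, hher]
    have : W A * W B = W B * W A := hmul.trans hmul'.symm
    linear_combination (norm := noncomm_ring) -this
  · have hc : W A * W B = W B * W A := hmul.trans hmul'.symm
    have hsq2 : ∀ J, (1 - W J) * (1 - W J) = (2 : ℂ) • (1 - W J) := fun J => by
      have : (1 - W J) * (1 - W J) = 1 - W J - W J + W J * W J := by noncomm_ring
      rw [this, hsq, two_smul]; abel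
    have hcomm : Commute (1 - W A) (1 - W B) :=
      (Commute.one_left _).sub_left ((Commute.one_right _).sub_right hc)
    rw [hcomm.symm.mul_mul_mul_comm, hsq2, hsq2, smul_mul_smul_comm]
    norm_num

/-- Adding `v` to `A` raises `C₂` by `S₂(v) + S₂(A) - S₂(A ∪ {v})`, which is nonnegative by
subadditivity. -/
theorem totalCorrelation_mono {n : ℕ} {ρ : Op n} (hρ : IsState ρ) :
    Monotone (totalCorrelation ρ) := by
  rw [Finset.monotone_iff_forall_le_insert]
  intro A v hv
  have h := purity_add_purity_le hρ (Finset.disjoint_singleton_left.mpr hv)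
  rw [← Finset.insert_eq] at h
  simp only [totalCorrelation, linearEntropy, Finset.sum_insert hv]
  linarith

theorem totalCorrelation_empty {n : ℕ} {ρ : Op n} (hρ : IsState ρ) :
    totalCorrelation ρ ∅ = 0 := by
  simp [totalCorrelation, linearEntropy, trace_marginal_empty_mul_self, hρ.2]

theorem totalCorrelation_singleton {n : ℕ} (ρ : Op n) (v : Fin n) :
    totalCorrelation ρ {v} = 0 := by
  simp [totalCorrelation]

/-! ### The Euler–Poincaré formula -/

theorem boundary_single {n : ℕ} (J : Finset (Fin n)) :
    boundary n (Pi.single J 1) = ∑ v ∈ J, Pi.single (J.erase v) 1 := by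
  simp [boundary, Pi.single_apply, ite_smul]

theorem boundary_boundary {n : ℕ} (c : Finset (Fin n) → ZMod 2) :
    boundary n (boundary n c) = 0 := by
  suffices h : boundary n ∘ₗ boundary n = 0 from LinearMap.congr_fun h c
  refine (Pi.basisFun (ZMod 2) (Finset (Fin n))).ext fun J => ?_
  simp only [Pi.basisFun_apply, LinearMap.comp_apply, boundary_single, map_sum,
    LinearMap.zero_apply]
  rw [Finset.sum_sigma']
  -- Removing `v` then `w` and removing `w` then `v` give the same set, so the terms cancel in pairs
  -- modulo two.
  refine Finset.sum_involution (fun p _ => ⟨p.2, p.1⟩) ?_ ?_ ?_ ?_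
  · rintro ⟨v, w⟩ _
    simp only [Finset.erase_right_comm (a := w) (b := v)]
    exact CharTwo.add_self_eq_zero _
  · rintro ⟨v, w⟩ h _
    simp only [Finset.mem_sigma, Finset.mem_erase] at h
    simp only [ne_eq, Sigma.mk.injEq, not_and]
    exact fun e => absurd e h.2.1
  · rintro ⟨v, w⟩ h
    simp only [Finset.mem_sigma, Finset.mem_erase] at h ⊢
    exact ⟨h.2.2, h.2.1.symm, h.1⟩
  · rintro ⟨v, w⟩ _
    rfl

theorem chains_mono {n : ℕ} {G H : Set (Finset (Fin n))} (h : G ⊆ H) (k : ℕ) :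
    chains G k ≤ chains H k :=
  fun _ hc J hJ => ⟨h (hc J hJ).1, (hc J hJ).2⟩

theorem single_mem_chains {n : ℕ} {G : Set (Finset (Fin n))} {k : ℕ} {J : Finset (Fin n)}
    (hJ : J ∈ G) (hk : J.card = k + 1) : Pi.single J 1 ∈ chains G k := by
  intro I hI
  obtain rfl : I = J := by
    by_contra h
    exact hI (Pi.single_eq_of_ne h 1)
  exact ⟨hJ, hk⟩

theorem chains_eq_bot {n : ℕ} (G : Set (Finset (Fin n))) {k : ℕ} (hk : n ≤ k) :
    chains G k = ⊥ := by
  refine eq_bot_iff.mpr fun c hc => ?_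
  rw [Submodule.mem_bot]
  ext J
  by_contra h
  have := (hc J h).2
  have := card_finset_fin_le J
  omega

theorem boundary_mem_chains {n : ℕ} {G : Set (Finset (Fin n))}
    (hG : IsRelLowerSet G Finset.Nonempty) {k : ℕ} {c : Finset (Fin n) → ZMod 2}
    (hc : c ∈ chains G (k + 1)) : boundary n c ∈ chains G k := by
  have hsum : boundary n c = ∑ J, c J • ∑ v ∈ J, Pi.single (J.erase v) 1 := by
    simp [boundary]
  rw [hsum]
  refine Submodule.sum_mem _ fun J _ => ?_
  by_cases hJ : c J = 0
  · rw [hJ, zero_smul]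
    exact zero_mem _
  · refine Submodule.smul_mem _ _ (Submodule.sum_mem _ fun v hv => ?_)
    have hcard := Finset.card_erase_of_mem hv
    have h1 := hc J hJ
    have h2 : (J.erase v).card = k + 1 := by omega
    refine single_mem_chains ((hG h1.1).2 (Finset.erase_subset v J) ?_) h2
    exact Finset.card_pos.mp (by omega)

theorem boundaries_le_cycles {n : ℕ} {G : Set (Finset (Fin n))}
    (hG : IsRelLowerSet G Finset.Nonempty) (k : ℕ) : boundaries G k ≤ cycles G k := by
  rintro _ ⟨c, hc, rfl⟩
  exact ⟨boundary_mem_chains hG hc, boundary_boundary c⟩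

/-- The rank of the boundary operator on the `k`-chains of `G`. -/
noncomputable def boundaryRank {n : ℕ} (G : Set (Finset (Fin n))) (k : ℕ) : ℕ :=
  Module.finrank (ZMod 2) ((chains G k).map (boundary n))

theorem boundaryRank_mono {n : ℕ} {G H : Set (Finset (Fin n))} (h : G ⊆ H) (k : ℕ) :
    boundaryRank G k ≤ boundaryRank H k :=
  Submodule.finrank_mono (Submodule.map_mono (chains_mono h k))

theorem finrank_cycles_add_boundaryRank {n : ℕ} (G : Set (Finset (Fin n))) (k : ℕ) :
    Module.finrank (ZMod 2) (cycles G k) + boundaryRank G k =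
      Module.finrank (ZMod 2) (chains G k) := by
  rw [← LinearMap.finrank_range_add_finrank_ker ((boundary n).domRestrict (chains G k)),
    LinearMap.range_domRestrict, LinearMap.ker_domRestrict, add_comm, boundaryRank, cycles]
  congr 1
  rw [← Submodule.finrank_map_subtype_eq (chains G k), Submodule.map_comap_subtype]

theorem reducedBetti_add_boundaryRank {n : ℕ} {G : Set (Finset (Fin n))}
    (hG : IsRelLowerSet G Finset.Nonempty) (k : ℕ) :
    reducedBetti G k + boundaryRank G k + boundaryRank G (k + 1) =
      Module.finrank (ZMod 2) (chains G k) := by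
  have h1 : reducedBetti G k + _ = _ := Submodule.finrank_quotient_add_finrank
    ((boundaries G k).submoduleOf (cycles G k))
  have h2 : Module.finrank (ZMod 2) ((boundaries G k).submoduleOf (cycles G k)) =
      boundaryRank G (k + 1) :=
    (Submodule.submoduleOfEquivOfLe (boundaries_le_cycles hG k)).finrank_eq
  have h3 := finrank_cycles_add_boundaryRank G k
  rw [h2] at h1
  omega

/-- The augmentation is onto the line spanned by `∅` as soon as there is a vertex; this rank is the
`-1` in the Euler–Poincaré formula. -/
theorem boundaryRank_zero {n : ℕ} {G : Set (Finset (Fin n))} {v : Fin n} (hv : {v} ∈ G) :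
    boundaryRank G 0 = 1 := by
  have h : (chains G 0).map (boundary n) = Submodule.span (ZMod 2) {Pi.single ∅ 1} := by
    refine le_antisymm ?_ ?_
    · rintro _ ⟨c, hc, rfl⟩
      have hsum : boundary n c = ∑ J, c J • ∑ v ∈ J, Pi.single (J.erase v) 1 := by
        simp [boundary]
      rw [hsum]
      refine Submodule.sum_mem _ fun J _ => ?_
      by_cases hJ : c J = 0
      · rw [hJ, zero_smul]
        exact zero_mem _
      · obtain ⟨w, rfl⟩ := Finset.card_eq_one.mp (hc J hJ).2
        refine Submodule.smul_mem _ _ ?_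
        simp
    · rw [Submodule.span_singleton_le_iff_mem]
      exact ⟨Pi.single {v} 1, single_mem_chains hv rfl, by simp [boundary_single]⟩
  rw [boundaryRank, h, finrank_span_singleton]
  exact fun h0 => one_ne_zero ((Pi.single_eq_same (M := fun _ => ZMod 2) ∅ 1).symm.trans
    (congrFun h0 ∅))

theorem boundaryRank_eq_zero {n : ℕ} (G : Set (Finset (Fin n))) {k : ℕ} (hk : n ≤ k) :
    boundaryRank G k = 0 := by
  rw [boundaryRank, chains_eq_bot G hk, Submodule.map_bot, finrank_bot]

theorem reducedBetti_eq_zero {n : ℕ} {G : Set (Finset (Fin n))}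
    (hG : IsRelLowerSet G Finset.Nonempty) {k : ℕ} (hk : n ≤ k) : reducedBetti G k = 0 := by
  have h := reducedBetti_add_boundaryRank hG k
  rw [chains_eq_bot G hk, finrank_bot] at h
  omega

open Classical in
theorem finrank_chains {n : ℕ} (G : Set (Finset (Fin n))) (k : ℕ) :
    Module.finrank (ZMod 2) (chains G k) =
      (Finset.univ.filter fun J : Finset (Fin n) => J ∈ G ∧ J.card = k + 1).card := by
  have h : chains G k = Submodule.span (ZMod 2) (Set.range
      fun J : {J : Finset (Fin n) // J ∈ G ∧ J.card = k + 1} =>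
        (Pi.single J.1 1 : Finset (Fin n) → ZMod 2)) := by
    refine le_antisymm (fun c hc => ?_) ?_
    · rw [pi_eq_sum_univ' c]
      refine Submodule.sum_mem _ fun J _ => ?_
      by_cases hJ : c J = 0
      · rw [hJ, zero_smul]
        exact zero_mem _
      · refine Submodule.smul_mem _ _ (Submodule.subset_span ⟨⟨J, hc J hJ⟩, ?_⟩)
        ext I
        simp [Pi.single_apply, eq_comm]
    · rw [Submodule.span_le]
      rintro _ ⟨J, rfl⟩
      exact single_mem_chains J.2.1 J.2.2
  rw [h, finrank_span_eq_card, Fintype.card_subtype]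
  have := (Pi.basisFun (ZMod 2) (Finset (Fin n))).linearIndependent.comp
    (fun J : {J : Finset (Fin n) // J ∈ G ∧ J.card = k + 1} => J.1) Subtype.val_injective
  simpa [Function.comp_def] using this

theorem sum_range_neg_one_pow_mul_add (N : ℕ) (r : ℕ → ℝ) :
    ∑ k ∈ Finset.range N, (-1 : ℝ) ^ k * (r k + r (k + 1)) = r 0 - (-1) ^ N * r N := by
  induction N with
  | zero => simp
  | succ N ih => rw [Finset.sum_range_succ, ih, pow_succ]; ring

open Classical in
/-- The **Euler–Poincaré formula** for reduced homology. -/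
theorem sum_reducedBetti {n : ℕ} {G : Set (Finset (Fin n))}
    (hG : IsRelLowerSet G Finset.Nonempty) {v : Fin n} (hv : {v} ∈ G) :
    ∑ k ∈ Finset.range n, (-1 : ℝ) ^ k * reducedBetti G k =
      (∑ J : Finset (Fin n), if J ∈ G then (-1 : ℝ) ^ (J.card + 1) else 0) - 1 := by
  have h1 : ∀ k, (reducedBetti G k : ℝ) = Module.finrank (ZMod 2) (chains G k) -
      (boundaryRank G k + boundaryRank G (k + 1)) := fun k => by
    rw [← reducedBetti_add_boundaryRank hG k]
    push_cast
    ring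
  simp_rw [h1, mul_sub, Finset.sum_sub_distrib]
  -- The ranks telescope: only the augmentation rank 1 and the vanishing rank in degree `n` survive.
  rw [sum_range_neg_one_pow_mul_add n (fun k => (boundaryRank G k : ℝ)), boundaryRank_zero hv,
    boundaryRank_eq_zero G le_rfl]
  simp only [Nat.cast_one, Nat.cast_zero, mul_zero, sub_zero, sub_left_inj]
  simp_rw [finrank_chains, Finset.card_filter, Nat.cast_sum, Finset.mul_sum]
  rw [Finset.sum_comm]
  refine Finset.sum_congr rfl fun J _ => ?_
  by_cases hJ : J ∈ G
  · have hpos := Finset.card_pos.mpr (hG hJ).1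
    have hle := card_finset_fin_le J
    rw [if_pos hJ, Finset.sum_eq_single (J.card - 1)]
    · have : J.card = J.card - 1 + 1 := by omega
      rw [if_pos ⟨hJ, this⟩, Nat.cast_one, mul_one]
      conv_rhs => rw [this]
      ring
    · intro k _ hk
      rw [if_neg (by omega)]
      simp
    · intro h
      exact absurd (Finset.mem_range.mpr (by omega)) h
  · simp [hJ]

/-! ### The integrated Euler characteristic -/

theorem totalCorrelation_nonneg {n : ℕ} {ρ : Op n} (hρ : IsState ρ) (J : Finset (Fin n)) :
    0 ≤ totalCorrelation ρ J :=
  (totalCorrelation_empty hρ).symm.le.trans (totalCorrelation_mono hρ (Finset.empty_subset J))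

theorem isRelLowerSet_sublevelComplex {n : ℕ} {ρ : Op n} (hρ : IsState ρ) (ε : ℝ) :
    IsRelLowerSet (sublevelComplex ρ ε) Finset.Nonempty :=
  fun _ hJ => ⟨hJ.1, fun _ hI hne => ⟨hne, (totalCorrelation_mono hρ hI).trans hJ.2⟩⟩

theorem sublevelComplex_mono {n : ℕ} (ρ : Op n) : Monotone (sublevelComplex ρ) :=
  fun _ _ h _ hJ => ⟨hJ.1, hJ.2.trans h⟩

/-- Betti numbers need not be monotone in `t`, but chain dimensions and boundary ranks are, and a
Betti number is a difference of these. -/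
theorem intervalIntegrable_reducedBetti {n : ℕ} {ρ : Op n} (hρ : IsState ρ) (k : ℕ) (a b : ℝ) :
    IntervalIntegrable (fun t => (reducedBetti (sublevelComplex ρ t) k : ℝ))
      MeasureTheory.volume a b := by
  have h : (fun t => (reducedBetti (sublevelComplex ρ t) k : ℝ)) = fun t =>
      (Module.finrank (ZMod 2) (chains (sublevelComplex ρ t) k) : ℝ) -
        boundaryRank (sublevelComplex ρ t) k - boundaryRank (sublevelComplex ρ t) (k + 1) := by
    funext t
    rw [← reducedBetti_add_boundaryRank (isRelLowerSet_sublevelComplex hρ t) k]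
    push_cast
    ring
  have hr : ∀ j, Monotone fun t => (boundaryRank (sublevelComplex ρ t) j : ℝ) :=
    fun j s t hst => Nat.cast_le.mpr (boundaryRank_mono (sublevelComplex_mono ρ hst) j)
  have hc : Monotone fun t =>
      (Module.finrank (ZMod 2) (chains (sublevelComplex ρ t) k) : ℝ) :=
    fun s t hst => Nat.cast_le.mpr
      (Submodule.finrank_mono (chains_mono (sublevelComplex_mono ρ hst) k))
  rw [h]
  exact (hc.intervalIntegrable.sub (hr k).intervalIntegrable).sub (hr (k + 1)).intervalIntegrable

theorem reducedIEC_eq_integral {n : ℕ} {ρ : Op n} (hρ : IsState ρ) (ε : ℝ) :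
    reducedIEC ρ ε = ∫ t in (0 : ℝ)..ε,
      ∑ k ∈ Finset.range n, (-1 : ℝ) ^ k * reducedBetti (sublevelComplex ρ t) k := by
  rw [intervalIntegral.integral_finsetSum
    fun k _ => (intervalIntegrable_reducedBetti hρ k 0 ε).const_mul _, reducedIEC, tsum_eq_sum]
  · simp_rw [intervalIntegral.integral_const_mul]
    rfl
  · intro k hk
    rw [Finset.mem_range, not_lt] at hk
    simp [reducedIntegratedBetti, reducedBetti_eq_zero (isRelLowerSet_sublevelComplex hρ _) hk]

theorem intervalIntegrable_ite_le (c a x y : ℝ) :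
    IntervalIntegrable (fun t : ℝ => if c ≤ t then a else 0) MeasureTheory.volume x y := by
  have h : Monotone fun t : ℝ => if c ≤ t then (1 : ℝ) else 0 := fun s t hst => by
    by_cases hs : c ≤ s
    · simp [hs, hs.trans hst]
    · simp only [hs, if_false]
      split_ifs <;> norm_num
  simpa using (h.intervalIntegrable (μ := MeasureTheory.volume) (a := x) (b := y)).const_mul a

theorem integral_ite_le {c ε : ℝ} (hc : 0 ≤ c) (hε : c ≤ ε) (a : ℝ) :
    ∫ t in (0 : ℝ)..ε, (if c ≤ t then a else 0) = a * (ε - c) := by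
  rw [← intervalIntegral.integral_add_adjacent_intervals (intervalIntegrable_ite_le c a 0 c)
    (intervalIntegrable_ite_le c a c ε)]
  have h1 : ∫ t in (0 : ℝ)..c, (if c ≤ t then a else 0) = ∫ t in (0 : ℝ)..c, (0 : ℝ) := by
    -- The integrand jumps at `t = c`, so the endpoint has to be left out.
    refine intervalIntegral.integral_congr_uIoo fun t ht => ?_
    rw [Set.uIoo_of_le hc] at ht
    exact if_neg (not_le.mpr ht.2)
  have h2 : ∫ t in c..ε, (if c ≤ t then a else 0) = ∫ t in c..ε, a := by
    refine intervalIntegral.integral_congr fun t ht => ?_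
    rw [Set.uIcc_of_le hε] at ht
    exact if_pos ht.1
  rw [h1, h2]
  simp [mul_comm]

theorem sum_neg_one_pow_card_add_one {n : ℕ} (hn : 0 < n) :
    ∑ J : Finset (Fin n), (-1 : ℝ) ^ (J.card + 1) = 0 := by
  have h := Finset.sum_powerset_neg_one_pow_card_of_nonempty
    (x := (Finset.univ : Finset (Fin n))) ⟨⟨0, hn⟩, Finset.mem_univ _⟩
  rw [Finset.powerset_univ] at h
  simp_rw [pow_succ, ← Finset.sum_mul]
  have h' : ∑ J : Finset (Fin n), (-1 : ℝ) ^ J.card = 0 := by exact_mod_cast h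
  rw [h', zero_mul]

/-- The coefficient of `f v` is the signed count of the sets containing `v`; toggling a second
vertex `w` cancels it, hence the bound on `n`. -/
theorem sum_neg_one_pow_mul_sum {n : ℕ} (hn : 2 ≤ n) (f : Fin n → ℝ) :
    ∑ J : Finset (Fin n), (-1 : ℝ) ^ (J.card + 1) * ∑ v ∈ J, f v = 0 := by
  have h : ∀ J : Finset (Fin n), (-1 : ℝ) ^ (J.card + 1) * ∑ v ∈ J, f v =
      ∑ v, (if v ∈ J then (-1 : ℝ) ^ (J.card + 1) else 0) * f v := fun J => by
    simp [Finset.mul_sum, ite_mul]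
  simp_rw [h]
  rw [Finset.sum_comm]
  refine Finset.sum_eq_zero fun v _ => ?_
  rw [← Finset.sum_mul]
  have : Nontrivial (Fin n) := Fin.nontrivial_iff_two_le.mpr hn
  obtain ⟨w, hw⟩ := exists_ne v
  have hu : (Finset.univ : Finset (Finset (Fin n))) =
      (insert w (Finset.univ.erase w)).powerset := by
    rw [Finset.insert_erase (Finset.mem_univ w), Finset.powerset_univ]
  rw [hu, Finset.sum_powerset_insert (Finset.notMem_erase w _), ← Finset.sum_add_distrib,
    Finset.sum_eq_zero, zero_mul]
  intro J hJ
  have hwJ : w ∉ J := fun h => Finset.notMem_erase w _ (Finset.mem_powerset.mp hJ h)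
  rw [Finset.card_insert_of_notMem hwJ]
  simp only [Finset.mem_insert, hw.symm, false_or]
  split_ifs <;> ring

open Classical in
theorem reducedIEC_eq {n : ℕ} (hn : 2 ≤ n) {ρ : Op n} (hρ : IsState ρ) {ε : ℝ} (hε0 : 0 ≤ ε)
    (hε : ∀ J, totalCorrelation ρ J ≤ ε) : reducedIEC ρ ε = interactionInformation ρ := by
  have h0 : ∀ t ∈ Set.uIcc 0 ε,
      ∑ k ∈ Finset.range n, (-1 : ℝ) ^ k * reducedBetti (sublevelComplex ρ t) k =
        ∑ J : Finset (Fin n),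
          if totalCorrelation ρ J ≤ t then (-1 : ℝ) ^ (J.card + 1) else 0 := by
    intro t ht
    rw [Set.uIcc_of_le hε0] at ht
    rw [sum_reducedBetti (isRelLowerSet_sublevelComplex hρ t) (v := ⟨0, by omega⟩)
      ⟨Finset.singleton_nonempty _, (totalCorrelation_singleton ρ _).trans_le ht.1⟩,
      ← Finset.add_sum_erase _ _ (Finset.mem_univ ∅),
      ← Finset.add_sum_erase _ _ (Finset.mem_univ ∅)]
    -- The empty set is not in the complex but does satisfy `C₂(∅) = 0 ≤ t`; its term on the right
    -- is exactly the `-1` on the left.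
    have he : ∅ ∉ sublevelComplex ρ t := fun h => Finset.not_nonempty_empty h.1
    rw [if_neg he, if_pos ((totalCorrelation_empty hρ).trans_le ht.1)]
    have : ∀ J ∈ (Finset.univ : Finset (Finset (Fin n))).erase ∅,
        (J ∈ sublevelComplex ρ t ↔ totalCorrelation ρ J ≤ t) := fun J hJ =>
      and_iff_right (Finset.nonempty_iff_ne_empty.mpr (Finset.ne_of_mem_erase hJ))
    rw [Finset.sum_congr rfl fun J hJ => if_congr (this J hJ) rfl rfl]
    simp
    ring
  rw [reducedIEC_eq_integral hρ, intervalIntegral.integral_congr h0,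
    intervalIntegral.integral_finsetSum fun J _ => intervalIntegrable_ite_le _ _ _ _]
  simp_rw [integral_ite_le (totalCorrelation_nonneg hρ _) (hε _), mul_sub,
    Finset.sum_sub_distrib, ← Finset.sum_mul]
  rw [sum_neg_one_pow_card_add_one (by omega), zero_mul, zero_sub]
  simp_rw [totalCorrelation, mul_sub, Finset.sum_sub_distrib]
  rw [sum_neg_one_pow_mul_sum hn, zero_sub, neg_neg, interactionInformation]

theorem interactionInformation_eq_zero {ρ : Op 0} (hρ : IsState ρ) :
    interactionInformation ρ = 0 := by
  rw [interactionInformation, Fintype.sum_eq_single ∅ fun J hJ => absurd (Subsingleton.elim _ _) hJ]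
  simp [linearEntropy, trace_marginal_empty_mul_self, hρ.2]

theorem tendsto_reducedIEC {n : ℕ} (hn : Even n) {ρ : Op n} (hρ : IsState ρ) :
    Filter.Tendsto (reducedIEC ρ) Filter.atTop (𝓝 (interactionInformation ρ)) := by
  rcases n.eq_zero_or_pos with rfl | hpos
  · rw [interactionInformation_eq_zero hρ]
    have : reducedIEC ρ = fun _ => 0 := by
      funext ε
      simp [reducedIEC_eq_integral hρ]
    rw [this]
    exact tendsto_const_nhds
  -- Evenness excludes `n = 1`, where the complex is a point for `t ≥ 0` and the left side is 0,
  -- while `I₂` is the entropy of the qubit.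
  · have hn2 : 2 ≤ n := by
      obtain ⟨m, rfl⟩ := hn
      omega
    refine tendsto_const_nhds.congr' ?_
    filter_upwards [Filter.eventually_ge_atTop 0, Filter.eventually_all.mpr
      fun J => Filter.eventually_ge_atTop (totalCorrelation ρ J)] with ε h0 h1
    exact (reducedIEC_eq hn2 hρ h0 h1).symm

theorem reducedIECInfty_eq {n : ℕ} (hn : Even n) {ρ : Op n} (hρ : IsState ρ) :
    reducedIECInfty ρ = interactionInformation ρ :=
  (tendsto_reducedIEC hn hρ).limUnder_eq

/-! ### Product operators and the spin flip -/

theorem localOp_mul {n : ℕ} (K L : Fin n → Matrix (Fin 2) (Fin 2) ℂ) :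
    localOp K * localOp L = localOp fun j => K j * L j := by
  ext a b
  simp only [localOp, Matrix.mul_apply, Matrix.of_apply, ← Finset.prod_mul_distrib]
  rw [Finset.prod_univ_sum, Fintype.piFinset_univ]

theorem localOp_transpose {n : ℕ} (K : Fin n → Matrix (Fin 2) (Fin 2) ℂ) :
    (localOp K)ᵀ = localOp fun j => (K j)ᵀ := rfl

theorem localOp_conjTranspose {n : ℕ} (K : Fin n → Matrix (Fin 2) (Fin 2) ℂ) :
    (localOp K)ᴴ = localOp fun j => (K j)ᴴ := by
  ext a b
  simp [localOp]

theorem localOp_one {n : ℕ} : localOp (fun _ : Fin n => (1 : Matrix (Fin 2) (Fin 2) ℂ)) = 1 := by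
  ext a b
  simp only [localOp, Matrix.of_apply, Matrix.one_apply, Finset.prod_ite_zero,
    Finset.prod_const_one, Finset.mem_univ, true_imp_iff, funext_iff]

theorem localOp_smul {n : ℕ} (c : Fin n → ℂ) (K : Fin n → Matrix (Fin 2) (Fin 2) ℂ) :
    (localOp fun j => c j • K j) = (∏ j, c j) • localOp K := by
  ext a b
  simp [localOp, Finset.prod_mul_distrib]

/-- The antisymmetric form on `ℂ²`. -/
def antisymm : Matrix (Fin 2) (Fin 2) ℂ := !![0, 1; -1, 0]

theorem antisymm_conjTranspose : antisymmᴴ = antisymmᵀ := by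
  ext i j
  fin_cases i <;> fin_cases j <;> simp [antisymm]

theorem antisymm_mul_transpose : antisymm * antisymmᵀ = 1 := by
  ext i j
  fin_cases i <;> fin_cases j <;> simp [antisymm, Matrix.mul_apply]

theorem antisymm_transpose_mul : antisymmᵀ * antisymm = 1 := by
  ext i j
  fin_cases i <;> fin_cases j <;> simp [antisymm, Matrix.mul_apply]

theorem transpose_mul_antisymm_mul (A : Matrix (Fin 2) (Fin 2) ℂ) :
    Aᵀ * antisymm * A = A.det • antisymm := by
  ext i j
  fin_cases i <;> fin_cases j <;>
    simp [antisymm, Matrix.mul_apply, Matrix.det_fin_two] <;> ring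

theorem antisymm_apply_mul_apply (a b c d : Fin 2) :
    antisymm a b * antisymm c d =
      -(if c = b ∧ d = a then 1 else 0) + (if c = a ∧ d = b then 1 else 0) := by
  fin_cases a <;> fin_cases b <;> fin_cases c <;> fin_cases d <;> simp [antisymm]

/-- The operator `antisymm ⊗ ⋯ ⊗ antisymm`, which is the spin flip up to a phase. -/
def spinFlip (n : ℕ) : Op n := localOp fun _ => antisymm

theorem spinFlip_conjTranspose (n : ℕ) : (spinFlip n)ᴴ = (spinFlip n)ᵀ := by
  simp only [spinFlip, localOp_conjTranspose, localOp_transpose, antisymm_conjTranspose]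

theorem spinFlip_mul_transpose (n : ℕ) : spinFlip n * (spinFlip n)ᵀ = 1 := by
  simp only [spinFlip, localOp_transpose, localOp_mul, antisymm_mul_transpose, localOp_one]

theorem spinFlip_transpose_mul (n : ℕ) : (spinFlip n)ᵀ * spinFlip n = 1 := by
  simp only [spinFlip, localOp_transpose, localOp_mul, antisymm_transpose_mul, localOp_one]

theorem localOp_transpose_mul_spinFlip_mul {n : ℕ} (K : Fin n → Matrix (Fin 2) (Fin 2) ℂ) :
    (localOp K)ᵀ * spinFlip n * localOp K = (∏ j, (K j).det) • spinFlip n := by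
  simp only [spinFlip, localOp_transpose, localOp_mul, transpose_mul_antisymm_mul, localOp_smul]

/-- On each qubit a product of two entries of the form is an entry of identity minus swap; in the
expansion over all qubits, `J` records where the swap was chosen. -/
theorem spinFlip_apply_mul_apply {n : ℕ} (x y z w : Fin n → Fin 2) :
    spinFlip n x y * spinFlip n z w = ∑ J : Finset (Fin n), (-1) ^ J.card *
      if z = J.piecewise y x ∧ w = J.piecewise x y then 1 else 0 := by
  simp only [spinFlip, localOp, Matrix.of_apply, ← Finset.prod_mul_distrib,
    antisymm_apply_mul_apply]
  rw [Finset.prod_add, Finset.powerset_univ]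
  refine Finset.sum_congr rfl fun J _ => ?_
  rw [Finset.prod_neg, mul_assoc, Finset.prod_ite_zero, Finset.prod_ite_zero, ite_zero_mul_ite_zero]
  simp only [Finset.prod_const_one, mul_one]
  congr 1
  refine if_congr ?_ rfl rfl
  simp only [funext_iff, Finset.piecewise, ← forall_and, Finset.mem_sdiff, Finset.mem_univ,
    true_and]
  refine forall_congr' fun i => ?_
  by_cases h : i ∈ J <;> simp [h]

/-- The trace of `ρ` times its spin flip. -/
noncomputable def flipOverlap {n : ℕ} (ρ : Op n) : ℂ :=
  ((spinFlip n)ᵀ * ρ * spinFlip n * ρᵀ).trace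

theorem sum_neg_one_pow_mul_purity {n : ℕ} (ρ : Op n) :
    ∑ J : Finset (Fin n), (-1) ^ J.card * (marginal ρ J * marginal ρ J).trace =
      flipOverlap ρ := by
  have h : flipOverlap ρ = ∑ x, ∑ y, ∑ z, ∑ w,
      ρ x z * ρ y w * (spinFlip n x y * spinFlip n z w) := by
    simp only [flipOverlap, Matrix.trace, Matrix.diag, Matrix.mul_apply, Finset.sum_mul,
      Matrix.transpose_apply]
    rw [Finset.sum_comm (s := Finset.univ (α := Fin n → Fin 2)) (t := Finset.univ)
      (f := fun x y => ∑ z, ∑ w, ρ x z * ρ y w * (spinFlip n x y * spinFlip n z w))]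
    refine Finset.sum_congr rfl fun y _ => ?_
    rw [Finset.sum_comm]
    conv_rhs => rw [Finset.sum_comm]
    refine Finset.sum_congr rfl fun z _ => ?_
    rw [Finset.sum_comm]
    refine Finset.sum_congr rfl fun x _ => Finset.sum_congr rfl fun w _ => ?_
    ring
  rw [h]
  simp_rw [spinFlip_apply_mul_apply, trace_marginal_mul_self, Finset.mul_sum]
  rw [Finset.sum_comm]
  refine Finset.sum_congr rfl fun x _ => ?_
  rw [Finset.sum_comm]
  refine Finset.sum_congr rfl fun y _ => ?_
  rw [← Fintype.sum_prod_type', Finset.sum_comm]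
  refine Finset.sum_congr rfl fun J _ => ?_
  rw [Fintype.sum_eq_single (J.piecewise y x, J.piecewise x y)]
  · simp
    ring
  · rintro ⟨z, w⟩ hne
    rw [if_neg fun h => hne (Prod.ext h.1 h.2)]
    simp

theorem interactionInformation_eq {n : ℕ} (hn : 0 < n) (ρ : Op n) :
    interactionInformation ρ = (flipOverlap ρ).re := by
  rw [← sum_neg_one_pow_mul_purity, Complex.re_sum, interactionInformation]
  simp_rw [linearEntropy, mul_sub, mul_one, Finset.sum_sub_distrib]
  rw [sum_neg_one_pow_card_add_one hn, zero_sub, ← Finset.sum_neg_distrib]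
  refine Finset.sum_congr rfl fun J _ => ?_
  have : ((-1 : ℂ) ^ J.card) = ((-1 : ℝ) ^ J.card : ℝ) := by push_cast; rfl
  rw [this, Complex.re_ofReal_mul]
  ring

/-- The form is invariant under each `A` up to `det A`; `K` gives one determinant factor and `K†`
its conjugate. -/
theorem flipOverlap_localOp {n : ℕ} (K : Fin n → Matrix (Fin 2) (Fin 2) ℂ) (ρ : Op n) :
    flipOverlap (localOp K * ρ * (localOp K)ᴴ) =
      (Complex.normSq (∏ j, (K j).det) : ℂ) * flipOverlap ρ := by
  have h1 := localOp_transpose_mul_spinFlip_mul K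
  have h2 : (localOp K)ᵀ * (spinFlip n)ᵀ * localOp K = (∏ j, (K j).det) • (spinFlip n)ᵀ := by
    have := congrArg Matrix.transpose h1
    simpa [Matrix.transpose_mul, Matrix.mul_assoc] using this
  have h3 : (localOp K)ᴴ * spinFlip n * (localOp K)ᴴᵀ =
      star (∏ j, (K j).det) • spinFlip n := by
    have := congrArg Matrix.conjTranspose h2
    rw [Matrix.conjTranspose_smul, ← spinFlip_conjTranspose, Matrix.conjTranspose_mul,
      Matrix.conjTranspose_mul, Matrix.conjTranspose_conjTranspose, ← Matrix.mul_assoc] at this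
    exact this
  have h4 : flipOverlap (localOp K * ρ * (localOp K)ᴴ) =
      (((localOp K)ᵀ * (spinFlip n)ᵀ * localOp K) * ρ *
        ((localOp K)ᴴ * spinFlip n * (localOp K)ᴴᵀ) * ρᵀ).trace := by
    rw [flipOverlap, Matrix.transpose_mul, Matrix.transpose_mul]
    simp only [← Matrix.mul_assoc]
    rw [Matrix.trace_mul_comm]
    simp only [← Matrix.mul_assoc]
  rw [h4, h2, h3, Complex.normSq_eq_conj_mul_self, flipOverlap]
  simp only [Matrix.smul_mul, Matrix.mul_smul, Matrix.trace_smul, smul_eq_mul]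
  rw [← mul_assoc]
  rfl

theorem flipOverlap_smul {n : ℕ} (c : ℂ) (ρ : Op n) :
    flipOverlap (c • ρ) = c ^ 2 * flipOverlap ρ := by
  simp only [flipOverlap, Matrix.transpose_smul, Matrix.smul_mul, Matrix.mul_smul,
    Matrix.trace_smul, smul_eq_mul]
  ring

-- Writing `ρᵀ = B† B` makes the overlap the trace of `B (ε† ρ ε) B†`, where `ε` is the spin flip.
open scoped MatrixOrder Matrix.Norms.L2Operator in
theorem flipOverlap_nonneg {n : ℕ} {ρ : Op n} (hρ : ρ.PosSemidef) : 0 ≤ (flipOverlap ρ).re := by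
  obtain ⟨B, hB⟩ := CStarAlgebra.nonneg_iff_eq_star_mul_self.mp hρ.transpose.nonneg
  have h := ((hρ.conjTranspose_mul_mul_same (spinFlip n)).mul_mul_conjTranspose_same B).trace_nonneg
  rw [Matrix.mul_assoc, Matrix.trace_mul_comm, Matrix.mul_assoc, spinFlip_conjTranspose] at h
  rw [flipOverlap, hB]
  exact (Complex.le_def.mp h).1

/-! ### Monotonicity under local operations -/

theorem outcomeProb_nonneg {n : ℕ} (K : Op n) {ρ : Op n} (hρ : ρ.PosSemidef) :
    0 ≤ outcomeProb K ρ :=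
  (Complex.le_def.mp (hρ.mul_mul_conjTranspose_same K).trace_nonneg).1

theorem trace_eq_outcomeProb {n : ℕ} (K : Op n) {ρ : Op n} (hρ : ρ.PosSemidef) :
    (K * ρ * Kᴴ).trace = outcomeProb K ρ := by
  refine Complex.ext rfl ?_
  exact (Complex.le_def.mp (hρ.mul_mul_conjTranspose_same K).trace_nonneg).2.symm

theorem isState_postState {n : ℕ} {K ρ : Op n} (hρ : IsState ρ) (hp : 0 < outcomeProb K ρ) :
    IsState (postState K ρ) := by
  refine ⟨(hρ.1.mul_mul_conjTranspose_same K).smul ?_, ?_⟩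
  · rw [← Complex.ofReal_inv]
    exact Complex.zero_le_real.mpr (inv_nonneg.mpr hp.le)
  · rw [postState, Matrix.trace_smul, trace_eq_outcomeProb K hρ.1, smul_eq_mul,
      inv_mul_cancel₀ (Complex.ofReal_ne_zero.mpr hp.ne')]

/-- A Cauchy–Schwarz inequality: if `L` inverts `K` up to the scalar `d`, then `|d|²` is at most
the product of the outcome probabilities of `K` and `L†`. -/
theorem normSq_le_outcomeProb_mul {n : ℕ} {K L ρ : Op n} {d : ℂ} (hρ : IsState ρ)
    (hp : 0 < outcomeProb K ρ) (hLK : L * K = d • 1) :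
    Complex.normSq d ≤ outcomeProb K ρ * outcomeProb Lᴴ ρ := by
  -- With `X = d̄ K - p L†`, expanding `Tr (X ρ X†) ≥ 0` gives `p (p q - |d|²) ≥ 0`.
  have h := (hρ.1.mul_mul_conjTranspose_same
    (star d • K - (outcomeProb K ρ : ℂ) • Lᴴ)).trace_nonneg
  have h1 : (K * ρ * L).trace = d := by
    rw [Matrix.trace_mul_comm, ← Matrix.mul_assoc, hLK]
    simp [hρ.2]
  have h2 : (Lᴴ * ρ * Kᴴ).trace = star d := by
    rw [← h1, ← Matrix.trace_conjTranspose]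
    simp [Matrix.conjTranspose_mul, hρ.1.1.eq, Matrix.mul_assoc]
  have h3 := trace_eq_outcomeProb K hρ.1
  have h4 := trace_eq_outcomeProb Lᴴ hρ.1
  rw [Matrix.conjTranspose_conjTranspose] at h4
  simp only [Matrix.conjTranspose_sub, Matrix.conjTranspose_smul,
    Matrix.conjTranspose_conjTranspose, Matrix.sub_mul, Matrix.mul_sub, Matrix.smul_mul,
    Matrix.mul_smul, Matrix.trace_sub, Matrix.trace_smul, h1, h2, h3, h4, star_star,
    smul_eq_mul] at h
  set p := outcomeProb K ρ
  set q := outcomeProb Lᴴ ρ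
  have h5 := (Complex.le_def.mp h).1
  have h6 : 0 ≤ p * (p * q - Complex.normSq d) := by
    simp [Complex.normSq_apply] at h5 ⊢
    nlinarith
  linarith [nonneg_of_mul_nonneg_right h6 hp]

theorem sum_outcomeProb {n m : ℕ} {ρ : Op n} (hρ : IsState ρ) (K : Fin m → Op n)
    (hK : ∑ i, (K i)ᴴ * K i = 1) : ∑ i, outcomeProb (K i) ρ = 1 := by
  have h : ∀ i, outcomeProb (K i) ρ = ((K i)ᴴ * K i * ρ).trace.re := fun i => by
    rw [outcomeProb, Matrix.trace_mul_comm, ← Matrix.mul_assoc]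
  simp_rw [h]
  rw [← Complex.re_sum, ← Matrix.trace_sum, ← Matrix.sum_mul, hK, Matrix.one_mul, hρ.2,
    Complex.one_re]

/-- The adjugate `K̃ = ε† Kᵀ ε` of a product operator, with `ε` the spin flip. -/
def flipAdjugate {n : ℕ} (K : Op n) : Op n := (spinFlip n)ᵀ * Kᵀ * spinFlip n

theorem flipAdjugate_mul {n : ℕ} (K : Fin n → Matrix (Fin 2) (Fin 2) ℂ) :
    flipAdjugate (localOp K) * localOp K = (∏ j, (K j).det) • (1 : Op n) := by
  rw [flipAdjugate, Matrix.mul_assoc, Matrix.mul_assoc, ← Matrix.mul_assoc _ (spinFlip n),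
    localOp_transpose_mul_spinFlip_mul, Matrix.mul_smul, spinFlip_transpose_mul]

/-- Each summand is the transpose of `K† K` conjugated by the unitary spin flip, so completeness of
the family carries over. -/
theorem sum_flipAdjugate {n m : ℕ} (K : Fin m → Op n) (hK : ∑ i, (K i)ᴴ * K i = 1) :
    ∑ i, (flipAdjugate (K i))ᴴᴴ * (flipAdjugate (K i))ᴴ = 1 := by
  have h : ∀ i, (flipAdjugate (K i))ᴴᴴ * (flipAdjugate (K i))ᴴ =
      (spinFlip n)ᵀ * ((K i)ᴴ * K i)ᵀ * spinFlip n := fun i => by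
    rw [Matrix.conjTranspose_conjTranspose, flipAdjugate, Matrix.conjTranspose_mul,
      Matrix.conjTranspose_mul, ← spinFlip_conjTranspose, Matrix.conjTranspose_conjTranspose,
      Matrix.transpose_mul]
    calc _ = (spinFlip n)ᴴ * (K i)ᵀ * (spinFlip n * (spinFlip n)ᴴ) * (K i)ᵀᴴ * spinFlip n := by
          simp only [Matrix.mul_assoc]
      _ = _ := by
          rw [spinFlip_conjTranspose, spinFlip_mul_transpose, Matrix.mul_one,
            Matrix.mul_assoc _ (K i)ᵀ]
          rfl
  simp_rw [h]
  rw [← Matrix.sum_mul, ← Matrix.mul_sum, ← Matrix.transpose_sum, hK, Matrix.transpose_one,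
    Matrix.mul_one, spinFlip_transpose_mul]

theorem isEntanglementMonotone_reducedIECInfty {n : ℕ} (hn : Even n) :
    IsEntanglementMonotone (reducedIECInfty : Op n → ℝ) := by
  intro ρ hρ m K hK
  rw [reducedIECInfty_eq hn hρ]
  rcases n.eq_zero_or_pos with rfl | hpos
  · rw [interactionInformation_eq_zero hρ]
    refine (Finset.sum_eq_zero fun i _ => ?_).le
    rcases (outcomeProb_nonneg (localOp (K i)) hρ.1).eq_or_lt with h0 | hp
    · rw [← h0, zero_mul]
    · have hs := isState_postState hρ hp
      rw [reducedIECInfty_eq hn hs, interactionInformation_eq_zero hs, mul_zero]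
  · have hQ := flipOverlap_nonneg hρ.1
    rw [interactionInformation_eq hpos]
    calc _ ≤ ∑ i, outcomeProb (flipAdjugate (localOp (K i)))ᴴ ρ * (flipOverlap ρ).re := by
          refine Finset.sum_le_sum fun i _ => ?_
          have hq := outcomeProb_nonneg (flipAdjugate (localOp (K i)))ᴴ hρ.1
          rcases (outcomeProb_nonneg (localOp (K i)) hρ.1).eq_or_lt with h0 | hp
          · rw [← h0, zero_mul]
            exact mul_nonneg hq hQ
          · have hle := normSq_le_outcomeProb_mul hρ hp (flipAdjugate_mul (K i))
            rw [reducedIECInfty_eq hn (isState_postState hρ hp), interactionInformation_eq hpos,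
              postState, flipOverlap_smul, flipOverlap_localOp, ← Complex.ofReal_inv,
              ← Complex.ofReal_pow, Complex.re_ofReal_mul, Complex.re_ofReal_mul]
            -- The coefficient of the overlap is now `p · p⁻² · |d|² = |d|² / p`, to be compared
            -- with `q`.
            rw [← mul_assoc, ← mul_assoc]
            refine mul_le_mul_of_nonneg_right ?_ hQ
            rw [← div_le_iff₀' hp] at hle
            refine le_trans (le_of_eq ?_) hle
            field_simp
      _ = (flipOverlap ρ).re := by
          rw [← Finset.sum_mul, sum_outcomeProb hρ _ (sum_flipAdjugate _ hK), one_mul]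

end QubitPersistence

theorem mainTheorem5 (n : ℕ) (hn : Even n) :
    (∀ ρ : QubitPersistence.Op n, QubitPersistence.IsState ρ →
      (∀ ε : ℝ, IsRelLowerSet (QubitPersistence.sublevelComplex ρ ε) Finset.Nonempty) ∧
      Filter.Tendsto (QubitPersistence.reducedIEC ρ) Filter.atTop
        (𝓝 (QubitPersistence.reducedIECInfty ρ)) ∧
      QubitPersistence.reducedIECInfty ρ = QubitPersistence.interactionInformation ρ) ∧
    QubitPersistence.IsEntanglementMonotone
      (QubitPersistence.reducedIECInfty : QubitPersistence.Op n → ℝ) := by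
  refine ⟨fun ρ hρ => ⟨fun ε => QubitPersistence.isRelLowerSet_sublevelComplex hρ ε, ?_,
    QubitPersistence.reducedIECInfty_eq hn hρ⟩,
    QubitPersistence.isEntanglementMonotone_reducedIECInfty hn⟩
  rw [QubitPersistence.reducedIECInfty_eq hn hρ]
  exact QubitPersistence.tendsto_reducedIEC hn hρ
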